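/- Let $n,m\in\mathbb{N}$, let $\mathcal{S}^n$ be the space of real symmetric $n\times n$ matrices with inner product $\mathrm{Tr}(XY)$, let $C\in\mathcal{S}^n$, $b\in\mathbb{R}^m$, let $\mathcal{A}:\mathcal{S}^n\to\mathbb{R}^m$ be linear with adjoint $\mathcal{A}^*:\mathbb{R}^m\to\mathcal{S}^n$, and let $\varepsilon>0$. Assume that the spectrahedron $\Omega=\{X\in\mathcal{S}^n:\mathcal{A}(X)=b,\ X\succeq0\}$ is compact. Consider the von Neumann entropy-regularized semidefinite program $$\mathbf{Q}_\varepsilon:\quad \rho_\varepsilon=\inf\{\mathrm{Tr}(CX)+\varepsilon\,\mathrm{Tr}(X\ln X): X\in\Omega\}$$ (with the convention $0\ln 0=0$ on the eigenvalues), and for $\lambda\in\mathbb{R}^m$ put $$G_\varepsilon(\lambda)=b^T\lambda+\inf_{X\succeq0}\{\mathrm{Tr}(X(C-\mathcal{A}^*\lambda))+\varepsilon\,\mathrm{Tr}(X\ln X)\},\qquad \hat G_\varepsilon(\lambda)=b^T\lambda-\varepsilon\,\mathrm{Tr}\exp\big((\mathcal{A}^*\lambda-C)/\varepsilon-I\big).$$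 Then: (1) If $\Omega\neq\emptyset$, then $\mathbf{Q}_\varepsilon$ has a unique optimal solution. (2) $G_\varepsilon(\lambda)=\hat G_\varepsilon(\lambda)$ for all $\lambda\in\mathbb{R}^m$. (3) Assume Slater's condition: some $X_0\in\Omega$ satisfies $X_0\succ0$. Then the unique optimal solution $X^*(\varepsilon)\in\Omega$ of $\mathbf{Q}_\varepsilon$ satisfies $X^*(\varepsilon)\succ0$, it is also the unique minimizer of the same cost over $\{X\in\Omega: X\succ0\}$, and $$\rho_\varepsilon=\mathrm{Tr}(C\,X^*(\varepsilon))+\varepsilon\,\mathrm{Tr}\big(X^*(\varepsilon)\ln X^*(\varepsilon)\big).$$ (4) Assume Slater's condition and that $\mathcal{A}^*$ is injective. Then $\hat G_\varepsilon=G_\varepsilon$ attains its maximum over $\mathbb{R}^m$ at a unique point $\lambda^*$, and $$\rho_\varepsilon=\max_{\lambda\in\mathbb{R}^m}G_\varepsilon(\lambda)=\max_{\lambda\in\mathbb{R}^m}\hat G_\varepsilon(\lambda)=\hat G_\varepsilon(\lambda^*)=b^T\lambda^*-\varepsilon\,\mathrm{Tr}\,X^*(\varepsilon).$$ -/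

import Mathlib

noncomputable section

namespace EntropySDP

open Matrix

/-- The space of real symmetric `n × n` matrices. -/
def SymMat (n : ℕ) : Submodule ℝ (Matrix (Fin n) (Fin n) ℝ) where
  carrier := {X | X.IsSymm}
  add_mem' := fun hX hY => hX.add hY
  zero_mem' := Matrix.isSymm_zero
  smul_mem' := fun c _ hX => hX.smul c

/-- The symmetrized matrix unit `(E_ij + E_ji) / 2`. -/
def symUnit (n : ℕ) (i j : Fin n) : SymMat n :=
  ⟨(1 / 2 : ℝ) • (Matrix.single i j 1 + Matrix.single j i 1), by
    change Matrix.IsSymm _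
    simp [Matrix.IsSymm, Matrix.transpose_add, add_comm]⟩

/-- The adjoint of a linear map from symmetric matrices to `ℝ^m`, with respect to the trace inner
product `Tr (X * Y)` and the standard inner product of `ℝ^m`, written in coordinates.
The defining identity is `trace_adj_mul`. -/
def adj {n m : ℕ} (𝒜 : SymMat n →ₗ[ℝ] (Fin m → ℝ)) : (Fin m → ℝ) →ₗ[ℝ] SymMat n where
  toFun l := ⟨Matrix.of fun i j => l ⬝ᵥ 𝒜 (symUnit n i j), by
    change Matrix.IsSymm _
    ext i j
    simp only [Matrix.transpose_apply, Matrix.of_apply]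
    congr 2
    simp [symUnit, add_comm]⟩
  map_add' l l' := by
    ext i j
    simp [add_dotProduct]
  map_smul' c l := by
    ext i j
    simp [smul_dotProduct]

lemma sum_smul_symUnit {n : ℕ} (X : SymMat n) :
    X = ∑ i, ∑ j, X.1 i j • symUnit n i j := by
  apply Subtype.ext
  ext a b
  have h : X.1 b a = X.1 a b := X.2.apply a b
  simp [symUnit, Matrix.sum_apply, Matrix.single_apply, Finset.sum_add_distrib,
    ite_and, h]
  ring

/-- The adjoint identity `Tr ((𝒜* l) * X) = lᵀ (𝒜 X)`. -/
lemma trace_adj_mul {n m : ℕ} (𝒜 : SymMat n →ₗ[ℝ] (Fin m → ℝ)) (l : Fin m → ℝ) (X : SymMat n) :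
    ((adj 𝒜 l).1 * X.1).trace = l ⬝ᵥ 𝒜 X := by
  conv_rhs => rw [sum_smul_symUnit X]
  simp only [map_sum, map_smul, dotProduct_sum, dotProduct_smul, smul_eq_mul, Matrix.trace,
    Matrix.diag, Matrix.mul_apply, adj, LinearMap.coe_mk, AddHom.coe_mk, Matrix.of_apply]
  refine Finset.sum_congr rfl fun i _ => Finset.sum_congr rfl fun j _ => ?_
  rw [X.2.apply i j, mul_comm]

/-- The spectrahedron `Ω = {X : 𝒜 X = b, X ⪰ 0}`. -/
def feasible {n m : ℕ} (𝒜 : SymMat n →ₗ[ℝ] (Fin m → ℝ)) (b : Fin m → ℝ) : Set (SymMat n) :=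
  {X | 𝒜 X = b ∧ X.1.PosSemidef}

/-- The positive definite feasible points `{X : 𝒜 X = b, X ≻ 0}`. -/
def strictFeasible {n m : ℕ} (𝒜 : SymMat n →ₗ[ℝ] (Fin m → ℝ)) (b : Fin m → ℝ) :
    Set (SymMat n) :=
  {X | 𝒜 X = b ∧ X.1.PosDef}

/-- Slater's condition: some point of `Ω` is positive definite. -/
def Slater {n m : ℕ} (𝒜 : SymMat n →ₗ[ℝ] (Fin m → ℝ)) (b : Fin m → ℝ) : Prop :=
  ∃ X₀ ∈ feasible 𝒜 b, X₀.1.PosDef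

/-- The von Neumann entropy `Tr (X ln X)`, with `ln X` given by the functional calculus. On a
positive semidefinite matrix it is the sum of `σ ln σ` over the eigenvalues, where `0 ln 0 = 0`. -/
def vonNeumann {n : ℕ} (X : SymMat n) : ℝ :=
  (X.1 * cfc Real.log X.1).trace

/-- The regularized cost `Tr (C X) + ε Tr (X ln X)`. -/
def cost {n : ℕ} (C : SymMat n) (ε : ℝ) (X : SymMat n) : ℝ :=
  (C.1 * X.1).trace + ε * vonNeumann X

/-- `X` is an optimal solution of the problem of minimizing the regularized cost over `S`. -/
def IsOptimal {n : ℕ} (C : SymMat n) (ε : ℝ) (S : Set (SymMat n)) (X : SymMat n) : Prop :=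
  X ∈ S ∧ IsMinOn (cost C ε) S X

/-- The optimal value `ρ_ε` of the regularized problem. -/
def optValue {n m : ℕ} (C : SymMat n) (𝒜 : SymMat n →ₗ[ℝ] (Fin m → ℝ)) (b : Fin m → ℝ)
    (ε : ℝ) : ℝ :=
  sInf (cost C ε '' feasible 𝒜 b)

/-- The Lagrangian dual function
`G_ε(l) = bᵀ l + inf_{X ⪰ 0} (Tr (X (C - 𝒜* l)) + ε Tr (X ln X))`. -/
def lagrangeDual {n m : ℕ} (C : SymMat n) (𝒜 : SymMat n →ₗ[ℝ] (Fin m → ℝ)) (b : Fin m → ℝ)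
    (ε : ℝ) (l : Fin m → ℝ) : EReal :=
  ((b ⬝ᵥ l : ℝ) : EReal) + ⨅ X : {X : SymMat n // X.1.PosSemidef},
    (((X.1.1 * (C - adj 𝒜 l).1).trace + ε * vonNeumann X.1 : ℝ) : EReal)

/-- The explicit dual function `bᵀ l - ε Tr exp ((𝒜* l - C) / ε - I)`. -/
def explicitDual {n m : ℕ} (C : SymMat n) (𝒜 : SymMat n →ₗ[ℝ] (Fin m → ℝ)) (b : Fin m → ℝ)
    (ε : ℝ) (l : Fin m → ℝ) : ℝ :=
  b ⬝ᵥ l - ε * (NormedSpace.exp (ε⁻¹ • (adj 𝒜 l - C).1 - 1)).trace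

end EntropySDP

end

/-! Everything rests on one identity. With `H = (𝒜* l - C)/ε - I`, the Lagrangian at `X` equals `ε
D(X, exp H) - ε Tr exp H`, where `D` is the unnormalized relative entropy (`lagrangian_eq`). Klein's
inequality says `D ≥ 0`, with equality only at `X = exp H`. This evaluates the infimum defining
`G_ε` and turns the duality gap of a feasible `X` into `ε D(X, exp H)`.

Under Slater's condition the dual has a maximizer, and its first-order condition says precisely that
`exp H` is feasible. The gap there is zero, so `exp H` is the primal optimum and is positive
definite. Any other dual maximizer gives the same exponential, hence the same `𝒜* l`.

Without Slater's condition, existence comes from compactness and lower semicontinuity, and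
uniqueness from Klein's inequality against a midpoint. -/

noncomputable section

namespace EntropySDP

open Matrix

/-! ### Spectral calculus in two eigenbases. -/

section Matrices

variable {ι : Type*} [Fintype ι] [DecidableEq ι] {X Y H N : Matrix ι ι ℝ}

lemma cfc_eq_mul_diagonal_mul (hX : X.IsHermitian) (f : ℝ → ℝ) :
    cfc f X = (hX.eigenvectorUnitary : Matrix ι ι ℝ) * diagonal (fun i => f (hX.eigenvalues i)) *
      (hX.eigenvectorUnitary : Matrix ι ι ℝ)ᴴ := by
  rw [hX.cfc_eq, Matrix.IsHermitian.cfc, Unitary.conjStarAlgAut_apply]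
  rfl

lemma cfc_id_of_isHermitian (hX : X.IsHermitian) : cfc (fun x : ℝ => x) X = X :=
  cfc_id' ℝ X hX.isSelfAdjoint

lemma cfc_one_of_isHermitian (hX : X.IsHermitian) : cfc (fun _ : ℝ => (1 : ℝ)) X = 1 :=
  cfc_const_one ℝ X hX.isSelfAdjoint

lemma eigenvectorUnitary_conjTranspose_mul (hX : X.IsHermitian) :
    (hX.eigenvectorUnitary : Matrix ι ι ℝ)ᴴ * (hX.eigenvectorUnitary : Matrix ι ι ℝ) = 1 :=
  Unitary.coe_star_mul_self hX.eigenvectorUnitary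

lemma eigenvectorUnitary_mul_conjTranspose (hX : X.IsHermitian) :
    (hX.eigenvectorUnitary : Matrix ι ι ℝ) * (hX.eigenvectorUnitary : Matrix ι ι ℝ)ᴴ = 1 :=
  Unitary.coe_mul_star_self hX.eigenvectorUnitary

/-- The matrix of inner products of the eigenvectors of two symmetric matrices. -/
def overlap (hX : X.IsHermitian) (hY : Y.IsHermitian) : Matrix ι ι ℝ :=
  (hX.eigenvectorUnitary : Matrix ι ι ℝ)ᴴ * (hY.eigenvectorUnitary : Matrix ι ι ℝ)

/-- Reduces trace inequalities to scalar ones: the weights are nonnegative and independent of `f`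
and `g`. -/
lemma trace_cfc_mul_cfc (hX : X.IsHermitian) (hY : Y.IsHermitian) (f g : ℝ → ℝ) :
    (cfc f X * cfc g Y).trace =
      ∑ i, ∑ j, overlap hX hY i j ^ 2 * (f (hX.eigenvalues i) * g (hY.eigenvalues j)) := by
  rw [cfc_eq_mul_diagonal_mul hX, cfc_eq_mul_diagonal_mul hY]
  set U := (hX.eigenvectorUnitary : Matrix ι ι ℝ)
  set V := (hY.eigenvectorUnitary : Matrix ι ι ℝ)
  set a := fun i => f (hX.eigenvalues i)
  set c := fun j => g (hY.eigenvalues j)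
  have h : (U * diagonal a * Uᴴ * (V * diagonal c * Vᴴ)).trace =
      (diagonal a * overlap hX hY * diagonal c * (overlap hX hY)ᴴ).trace := by
    have : U * diagonal a * Uᴴ * (V * diagonal c * Vᴴ) =
        U * (diagonal a * (Uᴴ * V) * diagonal c * Vᴴ) := by simp only [Matrix.mul_assoc]
    rw [this, Matrix.trace_mul_comm]
    simp [overlap, U, V, Matrix.mul_assoc]
  rw [h]
  simp only [Matrix.trace, Matrix.diag, Matrix.mul_apply (M := _ * _ * _), Matrix.mul_diagonal,
    Matrix.diagonal_mul, conjTranspose_apply, star_trivial]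
  exact Finset.sum_congr rfl fun i _ => Finset.sum_congr rfl fun j _ => by simp only [a, c]; ring

lemma trace_cfc (hX : X.IsHermitian) (f : ℝ → ℝ) :
    (cfc f X).trace = ∑ i, f (hX.eigenvalues i) := by
  rw [cfc_eq_mul_diagonal_mul hX, Matrix.trace_mul_comm, ← Matrix.mul_assoc,
    eigenvectorUnitary_conjTranspose_mul, Matrix.one_mul, Matrix.trace_diagonal]

lemma cfc_mul_cfc (hX : X.IsHermitian) (f g : ℝ → ℝ) :
    cfc f X * cfc g X = cfc (fun x => f x * g x) X := by
  rw [cfc_eq_mul_diagonal_mul hX, cfc_eq_mul_diagonal_mul hX, cfc_eq_mul_diagonal_mul hX,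
    Matrix.mul_assoc, ← Matrix.mul_assoc _ (_ * diagonal _), ← Matrix.mul_assoc _ᴴ,
    eigenvectorUnitary_conjTranspose_mul, Matrix.one_mul, ← Matrix.mul_assoc, Matrix.mul_assoc _
    (diagonal _) (diagonal _), diagonal_mul_diagonal]

/-- The product is the `i`-th coordinate, in the eigenbasis of `X`, of `X` applied to the `j`-th
eigenvector of `Y`, which lies in the kernel of `Y`. -/
lemma overlap_mul_eigenvalue_eq_zero (hX : X.IsHermitian) (hY : Y.IsHermitian)
    (hker : ∀ v, Y *ᵥ v = 0 → X *ᵥ v = 0) {j : ι} (hj : hY.eigenvalues j = 0) (i : ι) :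
    hX.eigenvalues i * overlap hX hY i j = 0 := by
  have h1 : X *ᵥ ⇑(hY.eigenvectorBasis j) = 0 := by
    apply hker
    rw [hY.mulVec_eigenvectorBasis, hj, zero_smul]
  have h2 : diagonal (fun i => hX.eigenvalues i) * overlap hX hY =
      (hX.eigenvectorUnitary : Matrix ι ι ℝ)ᴴ * (X * (hY.eigenvectorUnitary : Matrix ι ι ℝ)) := by
    have h := (cfc_id_of_isHermitian hX).symm.trans (cfc_eq_mul_diagonal_mul hX _)
    rw [← Matrix.mul_assoc _ X, show (hX.eigenvectorUnitary : Matrix ι ι ℝ)ᴴ * X = _ from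
      congrArg _ h]
    simp only [overlap, ← Matrix.mul_assoc]
    rw [eigenvectorUnitary_conjTranspose_mul, Matrix.one_mul]
  have h3 : ∀ k, (X * (hY.eigenvectorUnitary : Matrix ι ι ℝ)) k j = 0 := fun k =>
    congrFun h1 k
  have h4 := congrFun (congrFun h2 i) j
  rw [Matrix.diagonal_mul, Matrix.mul_apply] at h4
  rw [h4]
  simp [h3]

lemma eq_of_eigenvalue_mul_overlap (hX : X.IsHermitian) (hY : Y.IsHermitian)
    (h : ∀ i j, hX.eigenvalues i * overlap hX hY i j = overlap hX hY i j * hY.eigenvalues j) :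
    X = Y := by
  have h1 : diagonal (fun i => hX.eigenvalues i) * overlap hX hY =
      overlap hX hY * diagonal (fun i => hY.eigenvalues i) := by
    ext i j
    rw [Matrix.diagonal_mul, Matrix.mul_diagonal, h]
  rw [← cfc_id_of_isHermitian hX, ← cfc_id_of_isHermitian hY, cfc_eq_mul_diagonal_mul hX,
    cfc_eq_mul_diagonal_mul hY]
  set U := (hX.eigenvectorUnitary : Matrix ι ι ℝ) with hU
  set V := (hY.eigenvectorUnitary : Matrix ι ι ℝ) with hV
  have hVV : V * Vᴴ = 1 := eigenvectorUnitary_mul_conjTranspose hY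
  have hUU : U * Uᴴ = 1 := eigenvectorUnitary_mul_conjTranspose hX
  have hW : overlap hX hY = Uᴴ * V := rfl
  rw [hW] at h1
  calc U * diagonal (fun i => hX.eigenvalues i) * Uᴴ
      = U * (diagonal (fun i => hX.eigenvalues i) * (Uᴴ * V)) * Vᴴ := by
        simp only [Matrix.mul_assoc, hVV, Matrix.mul_one]
    _ = (U * Uᴴ) * V * diagonal (fun i => hY.eigenvalues i) * Vᴴ := by
        rw [h1]; simp only [Matrix.mul_assoc]
    _ = _ := by rw [hUU, Matrix.one_mul]

/-! ### Relative entropy and Klein's inequality. -/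

lemma mul_log_sub_nonneg {x y : ℝ} (hx : 0 ≤ x) (hy : 0 < y) :
    0 ≤ x * Real.log x - x * Real.log y + y - x := by
  rcases hx.eq_or_lt with rfl | hx
  · simpa using hy.le
  · have h := Real.log_le_sub_one_of_pos (div_pos hy hx)
    rw [Real.log_div hy.ne' hx.ne'] at h
    have h2 := mul_le_mul_of_nonneg_left h hx.le
    have h3 : x * (y / x - 1) = y - x := by field_simp
    nlinarith

lemma eq_of_mul_log_sub_eq_zero {x y : ℝ} (hx : 0 ≤ x) (hy : 0 < y)
    (h0 : x * Real.log x - x * Real.log y + y - x = 0) : x = y := by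
  rcases hx.eq_or_lt with rfl | hx
  · simp at h0; exact h0.symm
  · by_contra hne
    have h := Real.log_lt_sub_one_of_pos (div_pos hy hx)
      (fun h => hne ((div_eq_one_iff_eq hx.ne').1 h).symm)
    rw [Real.log_div hy.ne' hx.ne'] at h
    have h2 := mul_lt_mul_of_pos_left h hx
    have h3 : x * (y / x - 1) = y - x := by field_simp
    nlinarith

/-- The unnormalized quantum relative entropy `Tr (X ln X - X ln Y + Y - X)`. -/
def relEntropy (X Y : Matrix ι ι ℝ) : ℝ :=
  (X * cfc Real.log X).trace - (X * cfc Real.log Y).trace + Y.trace - X.trace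

lemma relEntropy_eq_sum (hX : X.IsHermitian) (hY : Y.IsHermitian) :
    relEntropy X Y = ∑ i, ∑ j, overlap hX hY i j ^ 2 *
      (hX.eigenvalues i * Real.log (hX.eigenvalues i) -
        hX.eigenvalues i * Real.log (hY.eigenvalues j) + hY.eigenvalues j - hX.eigenvalues i) := by
  have e1 : (X * cfc Real.log X).trace = _ :=
    calc (X * cfc Real.log X).trace
        = (cfc (fun x => x * Real.log x) X * cfc (fun _ => 1) Y).trace := by
          rw [cfc_one_of_isHermitian hY, Matrix.mul_one, ← cfc_mul_cfc hX (fun x => x),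
            cfc_id_of_isHermitian hX]
      _ = _ := trace_cfc_mul_cfc hX hY _ _
  have e2 : (X * cfc Real.log Y).trace = _ :=
    calc (X * cfc Real.log Y).trace = (cfc (fun x => x) X * cfc Real.log Y).trace := by
          rw [cfc_id_of_isHermitian hX]
      _ = _ := trace_cfc_mul_cfc hX hY _ _
  have e3 : Y.trace = _ :=
    calc Y.trace = (cfc (fun _ => 1) X * cfc (fun y => y) Y).trace := by
          rw [cfc_one_of_isHermitian hX, cfc_id_of_isHermitian hY, Matrix.one_mul]
      _ = _ := trace_cfc_mul_cfc hX hY _ _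
  have e4 : X.trace = _ :=
    calc X.trace = (cfc (fun x => x) X * cfc (fun _ => 1) Y).trace := by
          rw [cfc_one_of_isHermitian hY, cfc_id_of_isHermitian hX, Matrix.mul_one]
      _ = _ := trace_cfc_mul_cfc hX hY _ _
  rw [relEntropy, e1, e2, e3, e4]
  simp only [← Finset.sum_sub_distrib, ← Finset.sum_add_distrib]
  exact Finset.sum_congr rfl fun i _ => Finset.sum_congr rfl fun j _ => by ring

/-- The kernel inclusion handles zero eigenvalues of `Y`: there `Real.log 0 = 0` leaves `x log x -
x`, possibly negative, but either the weight or `x` vanishes. -/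
lemma relEntropy_term_nonneg (hX : X.PosSemidef) (hY : Y.PosSemidef)
    (hker : ∀ v, Y *ᵥ v = 0 → X *ᵥ v = 0) (i j : ι) :
    0 ≤ overlap hX.1 hY.1 i j ^ 2 * (hX.1.eigenvalues i * Real.log (hX.1.eigenvalues i) -
        hX.1.eigenvalues i * Real.log (hY.1.eigenvalues j) + hY.1.eigenvalues j -
        hX.1.eigenvalues i) := by
  rcases (hY.eigenvalues_nonneg j).eq_or_lt with hj | hj
  · rcases mul_eq_zero.1 (overlap_mul_eigenvalue_eq_zero hX.1 hY.1 hker hj.symm i) with h | h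
    · simp [h, ← hj]
    · simp [h]
  · exact mul_nonneg (sq_nonneg _) (mul_log_sub_nonneg (hX.eigenvalues_nonneg i) hj)

/-- Klein's inequality. -/
lemma relEntropy_nonneg (hX : X.PosSemidef) (hY : Y.PosSemidef)
    (hker : ∀ v, Y *ᵥ v = 0 → X *ᵥ v = 0) : 0 ≤ relEntropy X Y := by
  rw [relEntropy_eq_sum hX.1 hY.1]
  exact Finset.sum_nonneg fun i _ => Finset.sum_nonneg fun j _ =>
    relEntropy_term_nonneg hX hY hker i j

/-- The equality case of Klein's inequality. -/
lemma eq_of_relEntropy_eq_zero (hX : X.PosSemidef) (hY : Y.PosSemidef)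
    (hker : ∀ v, Y *ᵥ v = 0 → X *ᵥ v = 0) (h0 : relEntropy X Y = 0) : X = Y := by
  rw [relEntropy_eq_sum hX.1 hY.1] at h0
  have hz : ∀ i j, _ = _ := fun i j =>
    (Finset.sum_eq_zero_iff_of_nonneg fun j _ => relEntropy_term_nonneg hX hY hker i j).1
      ((Finset.sum_eq_zero_iff_of_nonneg fun i _ => Finset.sum_nonneg fun j _ =>
        relEntropy_term_nonneg hX hY hker i j).1 h0 i (Finset.mem_univ i)) j (Finset.mem_univ j)
  refine eq_of_eigenvalue_mul_overlap hX.1 hY.1 fun i j => ?_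
  rcases (hY.eigenvalues_nonneg j).eq_or_lt with hj | hj
  · rw [overlap_mul_eigenvalue_eq_zero hX.1 hY.1 hker hj.symm i, ← hj, mul_zero]
  · rcases mul_eq_zero.1 (hz i j) with h | h
    · simp [pow_eq_zero_iff two_ne_zero |>.1 h]
    · rw [eq_of_mul_log_sub_eq_zero (hX.eigenvalues_nonneg i) hj h, mul_comm]

lemma relEntropy_self (X : Matrix ι ι ℝ) : relEntropy X X = 0 := by simp [relEntropy]

lemma mulVec_eq_zero_of_posDef {ι : Type*} [Fintype ι] {Y : Matrix ι ι ℝ} (hY : Y.PosDef)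
    (X : Matrix ι ι ℝ) (v : ι → ℝ) (hv : Y *ᵥ v = 0) :
    X *ᵥ v = 0 := by
  by_contra h
  have hv0 : v ≠ 0 := by rintro rfl; simp at h
  have := hY.dotProduct_mulVec_pos hv0
  simp [hv] at this

/-! ### Matrix exponential and the variational formula for entropy. -/

lemma cfc_exp_eq_exp (hH : H.IsHermitian) : cfc Real.exp H = NormedSpace.exp H := by
  have hinv : (hH.eigenvectorUnitary : Matrix ι ι ℝ)⁻¹ =
      (hH.eigenvectorUnitary : Matrix ι ι ℝ)ᴴ :=
    Matrix.inv_eq_right_inv (eigenvectorUnitary_mul_conjTranspose hH)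
  have h : H = (hH.eigenvectorUnitary : Matrix ι ι ℝ) * diagonal (fun i => hH.eigenvalues i) *
      (hH.eigenvectorUnitary : Matrix ι ι ℝ)⁻¹ := by
    rw [hinv]
    exact (cfc_id_of_isHermitian hH).symm.trans (cfc_eq_mul_diagonal_mul hH _)
  rw [cfc_eq_mul_diagonal_mul hH, congrArg NormedSpace.exp h, Matrix.exp_conj _ _
    (Unitary.isUnit_coe (U := hH.eigenvectorUnitary)), Matrix.exp_diagonal, hinv]
  congr 3
  ext i
  rw [Pi.coe_exp, Real.exp_eq_exp_ℝ]

lemma cfc_log_exp (hH : H.IsHermitian) : cfc Real.log (NormedSpace.exp H) = H := by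
  rw [← cfc_exp_eq_exp hH, ← cfc_comp' Real.log Real.exp H
    ((H.finite_real_spectrum.image _).continuousOn _) (by fun_prop) hH.isSelfAdjoint]
  simpa using cfc_id_of_isHermitian hH

section

attribute [local instance] Matrix.linftyOpNormedRing Matrix.linftyOpNormedAlgebra

lemma continuous_exp_matrix :
    Continuous (NormedSpace.exp : Matrix ι ι ℝ → Matrix ι ι ℝ) :=
  NormedSpace.exp_continuous

end

lemma posDef_exp (hH : H.IsHermitian) : (NormedSpace.exp H).PosDef := by
  rw [← cfc_exp_eq_exp hH, cfc_eq_mul_diagonal_mul hH]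
  refine (Matrix.IsUnit.posDef_star_right_conjugate_iff
    (Unitary.isUnit_coe (U := hH.eigenvectorUnitary))).2 ?_
  exact Matrix.PosDef.diagonal fun i => Real.exp_pos _

lemma relEntropy_exp (X : Matrix ι ι ℝ) (hH : H.IsHermitian) :
    relEntropy X (NormedSpace.exp H) =
      (X * cfc Real.log X).trace - (X * H).trace + (NormedSpace.exp H).trace - X.trace := by
  rw [relEntropy, cfc_log_exp hH]

lemma relEntropy_exp_nonneg (hX : X.PosSemidef) (hH : H.IsHermitian) :
    0 ≤ relEntropy X (NormedSpace.exp H) :=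
  relEntropy_nonneg hX (posDef_exp hH).posSemidef (mulVec_eq_zero_of_posDef (posDef_exp hH) X)

lemma eq_exp_of_relEntropy_eq_zero (hX : X.PosSemidef) (hH : H.IsHermitian)
    (h : relEntropy X (NormedSpace.exp H) = 0) : X = NormedSpace.exp H :=
  eq_of_relEntropy_eq_zero hX (posDef_exp hH).posSemidef (mulVec_eq_zero_of_posDef (posDef_exp hH) X) h

/-- The gradient inequality for the convex function `H ↦ Tr (exp H)`. -/
lemma trace_exp_gradient (hH : H.IsHermitian) (hN : N.IsHermitian) :
    (NormedSpace.exp H).trace + (NormedSpace.exp H * N).trace ≤ (NormedSpace.exp (H + N)).trace := by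
  -- Klein's inequality for the pair `exp H`, `exp (H + N)`.
  have h := relEntropy_exp_nonneg (posDef_exp hH).posSemidef (hH.add hN)
  rw [relEntropy_exp _ (hH.add hN), cfc_log_exp hH, Matrix.mul_add, Matrix.trace_add] at h
  linarith

/-- A positive semidefinite matrix admits a symmetric `H` for which the entropy bound
`Tr (X H) + Tr X - Tr exp H ≤ Tr (X ln X)` is as tight as desired. -/
lemma exists_trace_log_lt (hX : X.PosSemidef) {r : ℝ} (hr : 0 < r) :
    ∃ H : Matrix ι ι ℝ, H.IsHermitian ∧
      (X * cfc Real.log X).trace - r < (X * H).trace + X.trace - (NormedSpace.exp H).trace := by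
  -- The witness is `H = log (X + d)`: the shift makes the logarithm genuine on the kernel of `X`
  -- and costs only `Tr (d I)`.
  obtain ⟨d, hd, hdr⟩ : ∃ d : ℝ, 0 < d ∧ Fintype.card ι * d < r :=
    ⟨r / (Fintype.card ι + 1), by positivity, by
      rw [mul_div_assoc', div_lt_iff₀ (by positivity)]; nlinarith⟩
  have hHH : (cfc (fun x => Real.log (x + d)) X).IsHermitian :=
    (cfc_predicate (R := ℝ) _ X : IsSelfAdjoint _)
  refine ⟨_, hHH, ?_⟩
  have hexp : NormedSpace.exp (cfc (fun x => Real.log (x + d)) X) = cfc (fun x => x + d) X := by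
    rw [← cfc_exp_eq_exp hHH, ← cfc_comp' Real.exp (fun x => Real.log (x + d)) X
      (by fun_prop) (X.finite_real_spectrum.continuousOn _) hX.1.isSelfAdjoint]
    refine cfc_congr fun x hx => ?_
    obtain ⟨i, rfl⟩ := hX.1.spectrum_real_eq_range_eigenvalues ▸ hx
    exact Real.exp_log (by linarith [hX.eigenvalues_nonneg i])
  have e : ∀ f : ℝ → ℝ, (X * cfc f X).trace = ∑ i, hX.1.eigenvalues i * f (hX.1.eigenvalues i) := by
    intro f
    rw [← trace_cfc hX.1 (fun x => x * f x), ← cfc_mul_cfc hX.1 (fun x => x),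
      cfc_id_of_isHermitian hX.1]
  have e' : X.trace = ∑ i, hX.1.eigenvalues i := by
    rw [← trace_cfc hX.1 (fun x => x), cfc_id_of_isHermitian hX.1]
  rw [hexp, e, e, e', trace_cfc hX.1, Finset.sum_add_distrib, Finset.sum_const, Finset.card_univ,
    nsmul_eq_mul]
  have : ∑ i, hX.1.eigenvalues i * Real.log (hX.1.eigenvalues i) ≤
      ∑ i, hX.1.eigenvalues i * Real.log (hX.1.eigenvalues i + d) := by
    refine Finset.sum_le_sum fun i _ => ?_
    rcases (hX.eigenvalues_nonneg i).eq_or_lt with h | h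
    · simp [← h]
    · exact mul_le_mul_of_nonneg_left (Real.log_le_log h (by linarith)) h.le
  linarith

/-! ### Perturbing a positive definite matrix. -/

lemma exists_smul_one_le (hX : X.PosDef) : ∃ c : ℝ, 0 < c ∧ (X - c • 1).PosSemidef := by
  obtain ⟨c, hc, hle⟩ : ∃ c : ℝ, 0 < c ∧ ∀ i, c ≤ hX.1.eigenvalues i := by
    rcases isEmpty_or_nonempty ι with _ | _
    · exact ⟨1, one_pos, fun i => isEmptyElim i⟩
    · obtain ⟨i, hi⟩ := Finite.exists_min hX.1.eigenvalues
      exact ⟨_, hX.eigenvalues_pos i, hi⟩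
  refine ⟨c, hc, ?_⟩
  have : X - c • 1 = cfc (fun x => x - c) X := by
    rw [cfc_sub _ _ _ (by fun_prop) (by fun_prop), cfc_id_of_isHermitian hX.1,
      cfc_const c X hX.1.isSelfAdjoint, Algebra.algebraMap_eq_smul_one]
  rw [this, cfc_eq_mul_diagonal_mul hX.1]
  exact (Matrix.PosSemidef.diagonal fun i => sub_nonneg.2 (hle i)).mul_mul_conjTranspose_same _

lemma exists_smul_one_add (hX : X.IsHermitian) : ∃ c : ℝ, 0 < c ∧ (c • 1 + X).PosSemidef := by
  obtain ⟨c, hc, hle⟩ : ∃ c : ℝ, 0 < c ∧ ∀ i, - c ≤ hX.eigenvalues i := by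
    refine ⟨1 + ∑ i, |hX.eigenvalues i|, by positivity, fun i => ?_⟩
    have := Finset.single_le_sum (f := fun i => |hX.eigenvalues i|) (fun i _ => abs_nonneg _)
      (Finset.mem_univ i)
    have h2 := neg_abs_le (hX.eigenvalues i)
    linarith
  refine ⟨c, hc, ?_⟩
  have : c • 1 + X = cfc (fun x => c + x) X := by
    rw [cfc_add _ _ _ (by fun_prop) (by fun_prop), cfc_id_of_isHermitian hX,
      cfc_const c X hX.isSelfAdjoint, Algebra.algebraMap_eq_smul_one]
  rw [this, cfc_eq_mul_diagonal_mul hX]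
  exact (Matrix.PosSemidef.diagonal fun i => by
    have := hle i; simp only [Pi.zero_apply]; linarith).mul_mul_conjTranspose_same _

lemma exists_posSemidef_add_smul (hX : X.PosDef) (hN : N.IsHermitian) :
    ∃ d : ℝ, 0 < d ∧ (X + d • N).PosSemidef := by
  obtain ⟨c, hc, h1⟩ := exists_smul_one_le hX
  obtain ⟨c', hc', h2⟩ := exists_smul_one_add hN
  refine ⟨c / c', by positivity, ?_⟩
  have := h1.add (h2.smul (a := c / c') (by positivity))
  rwa [smul_add, smul_smul, div_mul_cancel₀ _ hc'.ne', ← add_assoc, sub_add_cancel] at this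

end Matrices
-- The Lagrangian as a relative entropy.
section Program

variable {n m : ℕ} {C : SymMat n} {𝒜 : SymMat n →ₗ[ℝ] (Fin m → ℝ)} {b : Fin m → ℝ} {ε : ℝ}

lemma isHermitian_coe (X : SymMat n) : X.1.IsHermitian := by
  rw [Matrix.IsHermitian, Matrix.conjTranspose_eq_transpose_of_trivial]
  exact X.2

/-- A real Hermitian matrix as an element of the space of symmetric matrices. -/
def ofHermitian {X : Matrix (Fin n) (Fin n) ℝ} (hX : X.IsHermitian) : SymMat n :=
  ⟨X, by
    rw [Matrix.IsHermitian, Matrix.conjTranspose_eq_transpose_of_trivial] at hX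
    exact hX⟩

/-- The exponent `(𝒜* l - C) / ε - I` of the explicit dual function. -/
def dualExponent (C : SymMat n) (𝒜 : SymMat n →ₗ[ℝ] (Fin m → ℝ)) (ε : ℝ) (l : Fin m → ℝ) :
    Matrix (Fin n) (Fin n) ℝ :=
  ε⁻¹ • (adj 𝒜 l - C).1 - 1

lemma isHermitian_dualExponent (C : SymMat n) (𝒜 : SymMat n →ₗ[ℝ] (Fin m → ℝ)) (ε : ℝ)
    (l : Fin m → ℝ) : (dualExponent C 𝒜 ε l).IsHermitian :=
  (isHermitian_coe (ε⁻¹ • (adj 𝒜 l - C))).sub Matrix.isHermitian_one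

/-- The point at which the Lagrangian with multiplier `l` attains its minimum. -/
def dualPoint (C : SymMat n) (𝒜 : SymMat n →ₗ[ℝ] (Fin m → ℝ)) (ε : ℝ) (l : Fin m → ℝ) :
    SymMat n :=
  ofHermitian (posDef_exp (isHermitian_dualExponent C 𝒜 ε l)).1

lemma posDef_dualPoint (C : SymMat n) (𝒜 : SymMat n →ₗ[ℝ] (Fin m → ℝ)) (ε : ℝ)
    (l : Fin m → ℝ) : (dualPoint C 𝒜 ε l).1.PosDef :=
  posDef_exp (isHermitian_dualExponent C 𝒜 ε l)

lemma explicitDual_eq (C : SymMat n) (𝒜 : SymMat n →ₗ[ℝ] (Fin m → ℝ)) (b : Fin m → ℝ) (ε : ℝ)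
    (l : Fin m → ℝ) :
    explicitDual C 𝒜 b ε l = b ⬝ᵥ l - ε * (dualPoint C 𝒜 ε l).1.trace := rfl

/-- The logarithm of the dual point is its exponent; the `-I` there cancels the `Tr X` in the
relative entropy. -/
lemma lagrangian_eq (hε : 0 < ε) (l : Fin m → ℝ) (X : SymMat n) :
    (X.1 * (C - adj 𝒜 l).1).trace + ε * vonNeumann X =
      ε * relEntropy X.1 (dualPoint C 𝒜 ε l).1 - ε * (dualPoint C 𝒜 ε l).1.trace := by
  have h : relEntropy X.1 (dualPoint C 𝒜 ε l).1 = _ :=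
    relEntropy_exp X.1 (isHermitian_dualExponent C 𝒜 ε l)
  have h2 : (X.1 * dualExponent C 𝒜 ε l).trace =
      - ε⁻¹ * (X.1 * (C - adj 𝒜 l).1).trace - X.1.trace := by
    simp only [dualExponent, Submodule.coe_sub, Matrix.mul_sub, Matrix.mul_smul, Matrix.mul_one,
      Matrix.trace_sub, Matrix.trace_smul, smul_eq_mul]
    ring
  rw [h2] at h
  rw [h, vonNeumann]
  change _ = ε * (_ - _ + (dualPoint C 𝒜 ε l).1.trace - _) - _
  field_simp
  ring

lemma relEntropy_dualPoint_nonneg (l : Fin m → ℝ) {X : SymMat n} (hX : X.1.PosSemidef) :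
    0 ≤ relEntropy X.1 (dualPoint C 𝒜 ε l).1 :=
  relEntropy_exp_nonneg hX (isHermitian_dualExponent C 𝒜 ε l)

theorem lagrangeDual_eq_explicitDual (hε : 0 < ε) (l : Fin m → ℝ) :
    lagrangeDual C 𝒜 b ε l = (explicitDual C 𝒜 b ε l : EReal) := by
  have : (⨅ X : {X : SymMat n // X.1.PosSemidef},
      (((X.1.1 * (C - adj 𝒜 l).1).trace + ε * vonNeumann X.1 : ℝ) : EReal)) =
      ((-(ε * (dualPoint C 𝒜 ε l).1.trace) : ℝ) : EReal) := by
    apply le_antisymm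
    · refine iInf_le_of_le ⟨dualPoint C 𝒜 ε l, (posDef_dualPoint C 𝒜 ε l).posSemidef⟩ ?_
      rw [lagrangian_eq hε, relEntropy_self, mul_zero, zero_sub]
    · refine le_iInf fun X => ?_
      rw [lagrangian_eq hε, EReal.coe_le_coe_iff]
      linarith [mul_nonneg hε.le (relEntropy_dualPoint_nonneg (C := C) (𝒜 := 𝒜) (ε := ε) l X.2)]
  rw [lagrangeDual, this, ← EReal.coe_add, explicitDual_eq, sub_eq_add_neg]

/-- The duality gap is a relative entropy. -/
lemma cost_sub_explicitDual (hε : 0 < ε) (l : Fin m → ℝ) {X : SymMat n} (hX : 𝒜 X = b) :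
    cost C ε X - explicitDual C 𝒜 b ε l = ε * relEntropy X.1 (dualPoint C 𝒜 ε l).1 := by
  have h := lagrangian_eq (C := C) (𝒜 := 𝒜) hε l X
  have h1 : (X.1 * (C - adj 𝒜 l).1).trace = (C.1 * X.1).trace - b ⬝ᵥ l := by
    rw [← hX, dotProduct_comm, ← trace_adj_mul, Matrix.trace_mul_comm, ← Matrix.trace_sub,
      ← Matrix.sub_mul]
    rfl
  rw [cost, explicitDual_eq]
  linarith

/-! ### Primal existence and uniqueness. -/

/-- On the cone the cost is a supremum of continuous affine functions, one for each symmetric `H`;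
near `X`, one that is nearly tight at `X` suffices. -/
lemma lowerSemicontinuousOn_cost (C : SymMat n) (hε : 0 < ε) :
    LowerSemicontinuousOn (cost C ε) {X | X.1.PosSemidef} := by
  intro X hX y hy
  have hX' : X.1.PosSemidef := hX
  obtain ⟨H, hH, hlt⟩ := exists_trace_log_lt hX' (div_pos (sub_pos.2 hy) hε)
  let L : SymMat n → ℝ := fun Z => (C.1 * Z.1).trace +
    ε * ((Z.1 * H).trace + Z.1.trace - (NormedSpace.exp H).trace)
  have hL : Continuous L := by
    have : Continuous fun Z : SymMat n => Z.1 := continuous_subtype_val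
    fun_prop
  have hyL : y < L X := by
    have h := mul_lt_mul_of_pos_left hlt hε
    rw [mul_sub, mul_div_cancel₀ _ hε.ne'] at h
    simp only [L]
    simp only [cost, vonNeumann] at h
    linarith
  filter_upwards [self_mem_nhdsWithin,
    (hL.tendsto X).mono_left nhdsWithin_le_nhds (Ioi_mem_nhds hyL)] with Z hZ hyZ
  have h := relEntropy_exp_nonneg (show Z.1.PosSemidef from hZ) hH
  rw [relEntropy_exp _ hH] at h
  have h2 := mul_nonneg hε.le h
  have hyZ' : y < L Z := hyZ
  simp only [L] at hyZ'
  simp only [cost, vonNeumann]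
  nlinarith

/-- Strict midpoint convexity: the convexity defect at the midpoint `Z` is `ε (D(X, Z) + D(Y, Z))`,
which optimality forces to vanish. -/
lemma eq_of_isOptimal (hε : 0 < ε) {X Y : SymMat n} (hX : IsOptimal C ε (feasible 𝒜 b) X)
    (hY : IsOptimal C ε (feasible 𝒜 b) Y) : X = Y := by
  obtain ⟨⟨hXb, hXp⟩, hXm⟩ := hX
  obtain ⟨⟨hYb, hYp⟩, hYm⟩ := hY
  let Z : SymMat n := (1 / 2 : ℝ) • (X + Y)
  have hZ : Z.1 = (1 / 2 : ℝ) • (X.1 + Y.1) := rfl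
  have hZp : Z.1.PosSemidef := (hXp.add hYp).smul (by norm_num)
  have hZf : Z ∈ feasible 𝒜 b := by
    refine ⟨?_, hZp⟩
    simp only [Z, map_smul, map_add, hXb, hYb, ← two_smul ℝ b, smul_smul]
    norm_num
  have hker : ∀ v, Z.1 *ᵥ v = 0 → X.1 *ᵥ v = 0 ∧ Y.1 *ᵥ v = 0 := by
    intro v hv
    have h : star v ⬝ᵥ (X.1 *ᵥ v) + star v ⬝ᵥ (Y.1 *ᵥ v) = 0 := by
      rw [hZ, smul_mulVec, smul_eq_zero_iff_right (by norm_num), add_mulVec] at hv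
      rw [← dotProduct_add, hv, dotProduct_zero]
    have h1 := hXp.dotProduct_mulVec_nonneg v
    have h2 := hYp.dotProduct_mulVec_nonneg v
    exact ⟨(hXp.dotProduct_mulVec_zero_iff v).1 (by linarith),
      (hYp.dotProduct_mulVec_zero_iff v).1 (by linarith)⟩
  have hX0 := relEntropy_nonneg hXp hZp fun v hv => (hker v hv).1
  have hY0 := relEntropy_nonneg hYp hZp fun v hv => (hker v hv).2
  have hsum : cost C ε X + cost C ε Y - 2 * cost C ε Z =
      ε * (relEntropy X.1 Z.1 + relEntropy Y.1 Z.1) := by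
    have h1 : (X.1 * cfc Real.log Z.1).trace + (Y.1 * cfc Real.log Z.1).trace =
        2 * (Z.1 * cfc Real.log Z.1).trace := by
      conv_rhs => rw [← smul_eq_mul, ← Matrix.trace_smul, ← Matrix.smul_mul,
        show (2 : ℝ) • Z.1 = X.1 + Y.1 by rw [hZ, smul_smul]; norm_num]
      rw [Matrix.add_mul, Matrix.trace_add]
    have h2 : (C.1 * Z.1).trace = (1 / 2) * ((C.1 * X.1).trace + (C.1 * Y.1).trace) := by
      rw [hZ, Matrix.mul_smul, Matrix.mul_add, Matrix.trace_smul, Matrix.trace_add, smul_eq_mul]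
    have h3 : Z.1.trace = (1 / 2) * (X.1.trace + Y.1.trace) := by
      rw [hZ, Matrix.trace_smul, Matrix.trace_add, smul_eq_mul]
    simp only [cost, vonNeumann, relEntropy]
    rw [h2]
    linear_combination ε * h1 - 2 * ε * h3
  have hXZ : cost C ε X ≤ cost C ε Z := hXm hZf
  have hYZ : cost C ε Y ≤ cost C ε Z := hYm hZf
  have hle : relEntropy X.1 Z.1 + relEntropy Y.1 Z.1 ≤ 0 := by
    by_contra! h
    have := mul_pos hε h
    linarith
  have e1 := eq_of_relEntropy_eq_zero hXp hZp (fun v hv => (hker v hv).1) (by linarith)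
  have e2 := eq_of_relEntropy_eq_zero hYp hZp (fun v hv => (hker v hv).2) (by linarith)
  exact Subtype.ext (e1.trans e2.symm)

theorem existsUnique_isOptimal (hΩ : IsCompact (feasible 𝒜 b)) (hε : 0 < ε)
    (hne : (feasible 𝒜 b).Nonempty) : ∃! X, IsOptimal C ε (feasible 𝒜 b) X := by
  obtain ⟨X, hX, hmin⟩ := LowerSemicontinuousOn.exists_isMinOn hne hΩ
    ((lowerSemicontinuousOn_cost C hε).mono fun X hX => hX.2)
  exact ⟨X, ⟨hX, hmin⟩, fun Y hY => eq_of_isOptimal hε hY ⟨hX, hmin⟩⟩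

/-! ### Dual attainment and the first-order condition. -/

/-- Superlevel sets of the dual function are bounded in every direction. -/
lemma exists_bound_of_explicitDual_le (hε : 0 < ε) {X₀ : SymMat n} (hX₀ : 𝒜 X₀ = b)
    (hpos : X₀.1.PosDef) (c : ℝ) (N : SymMat n) :
    ∃ K, ∀ l, c ≤ explicitDual C 𝒜 b ε l → l ⬝ᵥ 𝒜 N ≤ K := by
  obtain ⟨d, hd, hp⟩ := exists_posSemidef_add_smul hpos (isHermitian_coe N)
  refine ⟨(cost C ε (X₀ + d • N) - c) / d, fun l hl => ?_⟩
  rw [le_div_iff₀ hd]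
  -- Weak duality for the right-hand side moved to `𝒜 (X₀ + d • N)`, which shifts the dual value by
  -- `d (l ⬝ᵥ 𝒜 N)`.
  have hgap := cost_sub_explicitDual (C := C) hε l (rfl : 𝒜 (X₀ + d • N) = _)
  have hnn := mul_nonneg hε.le (relEntropy_dualPoint_nonneg (C := C) (𝒜 := 𝒜) (ε := ε) l
    (X := X₀ + d • N) hp)
  have hshift : explicitDual C 𝒜 (𝒜 (X₀ + d • N)) ε l =
      explicitDual C 𝒜 b ε l + (l ⬝ᵥ 𝒜 N) * d := by
    rw [explicitDual_eq, explicitDual_eq, map_add, map_smul, hX₀, add_dotProduct, smul_dotProduct,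
      dotProduct_comm (𝒜 N), smul_eq_mul]
    ring
  linarith

/-- Since `bᵀ l = Tr ((𝒜* l) X₀)`, the objective depends only on `𝒜* l`. Maximizing over the range
of `𝒜*`, where superlevel sets are bounded, avoids assuming injectivity. -/
lemma exists_isMaxOn_explicitDual (hε : 0 < ε) {X₀ : SymMat n} (hX₀ : 𝒜 X₀ = b)
    (hpos : X₀.1.PosDef) : ∃ l, IsMaxOn (explicitDual C 𝒜 b ε) Set.univ l := by
  choose K hK using exists_bound_of_explicitDual_le (C := C) hε hX₀ hpos
    (explicitDual C 𝒜 b ε 0)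
  let p : Submodule ℝ (Matrix (Fin n) (Fin n) ℝ) :=
    LinearMap.range ((SymMat n).subtype ∘ₗ adj 𝒜)
  let B : Set (Matrix (Fin n) (Fin n) ℝ) :=
    Set.univ.pi fun i => Set.univ.pi fun j => Set.Icc (-K (-symUnit n i j)) (K (symUnit n i j))
  have hB : IsCompact B := isCompact_univ_pi fun i => isCompact_univ_pi fun j => isCompact_Icc
  have hp : IsClosed (p : Set (Matrix (Fin n) (Fin n) ℝ)) := p.closed_of_finiteDimensional
  have hmem : ∀ l, explicitDual C 𝒜 b ε 0 ≤ explicitDual C 𝒜 b ε l →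
      (adj 𝒜 l).1 ∈ B ∩ (p : Set (Matrix (Fin n) (Fin n) ℝ)) := by
    refine fun l hl => ⟨fun i _ j _ => ⟨?_, hK (symUnit n i j) l hl⟩, ⟨l, rfl⟩⟩
    have h := hK (-symUnit n i j) l hl
    rw [map_neg, dotProduct_neg] at h
    exact neg_le.1 h
  let g : Matrix (Fin n) (Fin n) ℝ → ℝ := fun M =>
    (M * X₀.1).trace - ε * (NormedSpace.exp (ε⁻¹ • (M - C.1) - 1)).trace
  have hg : Continuous g := by
    have := continuous_exp_matrix (ι := Fin n)
    fun_prop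
  have hgl : ∀ l, explicitDual C 𝒜 b ε l = g (adj 𝒜 l).1 := by
    intro l
    simp only [g]
    rw [trace_adj_mul, hX₀, dotProduct_comm]
    rfl
  obtain ⟨M, ⟨-, l, rfl⟩, hmax⟩ := (hB.inter_right hp).exists_isMaxOn
    ⟨_, hmem 0 le_rfl⟩ hg.continuousOn
  have hmax' : ∀ l', explicitDual C 𝒜 b ε 0 ≤ explicitDual C 𝒜 b ε l' →
      explicitDual C 𝒜 b ε l' ≤ explicitDual C 𝒜 b ε l := by
    intro l' hl'
    rw [hgl l', hgl l]
    exact hmax (hmem l' hl')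
  refine ⟨l, fun l' _ => ?_⟩
  rcases le_total (explicitDual C 𝒜 b ε 0) (explicitDual C 𝒜 b ε l') with h | h
  · exact hmax' l' h
  · exact h.trans (hmax' 0 le_rfl)

/-- A maximizer of the dual function yields a feasible point. -/
lemma map_dualPoint_of_isMaxOn (hε : 0 < ε) {l : Fin m → ℝ}
    (hl : IsMaxOn (explicitDual C 𝒜 b ε) Set.univ l) : 𝒜 (dualPoint C 𝒜 ε l) = b := by
  -- The gradient inequality is used at `l + t • μ`, stepping back to `l`; letting `t` tend to `0`
  -- then needs only continuity of `exp`, not its derivative.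
  have key : ∀ μ : Fin m → ℝ, ∀ t : ℝ, 0 < t →
      b ⬝ᵥ μ ≤ ((adj 𝒜 μ).1 * NormedSpace.exp (dualExponent C 𝒜 ε (l + t • μ))).trace := by
    intro μ t ht
    have hmax : explicitDual C 𝒜 b ε (l + t • μ) ≤ explicitDual C 𝒜 b ε l := hl (Set.mem_univ _)
    have hH := isHermitian_dualExponent C 𝒜 ε (l + t • μ)
    have hgrad := trace_exp_gradient hH (isHermitian_coe ((-(ε⁻¹ * t)) • adj 𝒜 μ))
    have hexp : dualExponent C 𝒜 ε (l + t • μ) + ((-(ε⁻¹ * t)) • adj 𝒜 μ : SymMat n).1 =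
        dualExponent C 𝒜 ε l := by
      simp only [dualExponent, map_add, map_smul, Submodule.coe_sub, Submodule.coe_add,
        Submodule.coe_smul]
      module
    rw [hexp] at hgrad
    have h1 : (NormedSpace.exp (dualExponent C 𝒜 ε (l + t • μ)) *
        ((-(ε⁻¹ * t)) • adj 𝒜 μ : SymMat n).1).trace = -(ε⁻¹ * t) *
        ((adj 𝒜 μ).1 * NormedSpace.exp (dualExponent C 𝒜 ε (l + t • μ))).trace := by
      rw [Submodule.coe_smul, Matrix.mul_smul, Matrix.trace_smul, Matrix.trace_mul_comm,
        smul_eq_mul]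
    rw [h1] at hgrad
    have h2 := mul_le_mul_of_nonneg_left hgrad hε.le
    change b ⬝ᵥ (l + t • μ) - ε * (NormedSpace.exp (dualExponent C 𝒜 ε (l + t • μ))).trace ≤
      b ⬝ᵥ l - ε * (NormedSpace.exp (dualExponent C 𝒜 ε l)).trace at hmax
    rw [dotProduct_add, dotProduct_smul, smul_eq_mul] at hmax
    refine le_of_mul_le_mul_left ?_ ht
    rw [mul_add, ← mul_assoc, show ε * -(ε⁻¹ * t) = -t by field_simp] at h2
    linarith
  have hlim : ∀ μ : Fin m → ℝ, b ⬝ᵥ μ ≤ μ ⬝ᵥ 𝒜 (dualPoint C 𝒜 ε l) := by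
    intro μ
    have hcont : Continuous fun t : ℝ =>
        ((adj 𝒜 μ).1 * NormedSpace.exp (dualExponent C 𝒜 ε (l + t • μ))).trace := by
      have h1 := continuous_exp_matrix (ι := Fin n)
      have h2 : Continuous fun t : ℝ => dualExponent C 𝒜 ε (l + t • μ) := by
        simp only [dualExponent, map_add, map_smul, Submodule.coe_sub, Submodule.coe_add,
          Submodule.coe_smul]
        fun_prop
      fun_prop
    have h0 : ((adj 𝒜 μ).1 * NormedSpace.exp (dualExponent C 𝒜 ε (l + (0 : ℝ) • μ))).trace =
        μ ⬝ᵥ 𝒜 (dualPoint C 𝒜 ε l) := by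
      rw [zero_smul, add_zero, ← trace_adj_mul]
      rfl
    rw [← h0]
    exact ge_of_tendsto ((hcont.tendsto 0).mono_left nhdsWithin_le_nhds)
      (Filter.eventually_of_mem self_mem_nhdsWithin fun t (ht : t ∈ Set.Ioi 0) => key μ t ht)
  -- Testing against the residual itself bounds its squared norm by `0`.
  have h := hlim (b - 𝒜 (dualPoint C 𝒜 ε l))
  rw [dotProduct_comm b, ← sub_nonpos, ← dotProduct_sub] at h
  have h0 : (b - 𝒜 (dualPoint C 𝒜 ε l)) ⬝ᵥ (b - 𝒜 (dualPoint C 𝒜 ε l)) = 0 :=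
    le_antisymm h (Finset.sum_nonneg fun i _ => mul_self_nonneg _)
  exact (sub_eq_zero.1 (dotProduct_self_eq_zero.1 h0)).symm

lemma dualPoint_injective (hε : 0 < ε) (hinj : Function.Injective (adj 𝒜)) :
    Function.Injective (dualPoint C 𝒜 ε) := by
  intro l l' h
  have h1 : dualExponent C 𝒜 ε l = dualExponent C 𝒜 ε l' := by
    rw [← cfc_log_exp (isHermitian_dualExponent C 𝒜 ε l),
      ← cfc_log_exp (isHermitian_dualExponent C 𝒜 ε l')]
    exact congrArg (fun X : SymMat n => cfc Real.log X.1) h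
  have h2 : (adj 𝒜 l - C).1 = (adj 𝒜 l' - C).1 :=
    smul_right_injective _ (inv_ne_zero hε.ne') (sub_left_injective h1)
  exact hinj (sub_left_injective (Subtype.ext h2))

end Program

end EntropySDP

end

/-! ### Strong duality and the final statement. -/

theorem corollary2p8 {n m : ℕ} (C : EntropySDP.SymMat n)
    (𝒜 : EntropySDP.SymMat n →ₗ[ℝ] (Fin m → ℝ)) (b : Fin m → ℝ)
    (hΩ : IsCompact (EntropySDP.feasible 𝒜 b)) (ε : ℝ) (hε : 0 < ε) :
    ((EntropySDP.feasible 𝒜 b).Nonempty →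
      ∃! X, EntropySDP.IsOptimal C ε (EntropySDP.feasible 𝒜 b) X) ∧
    (∀ l, EntropySDP.lagrangeDual C 𝒜 b ε l = (EntropySDP.explicitDual C 𝒜 b ε l : EReal)) ∧
    (EntropySDP.Slater 𝒜 b →
      ∃ Xs ∈ EntropySDP.feasible 𝒜 b, Xs.1.PosDef ∧
        (∀ X, EntropySDP.IsOptimal C ε (EntropySDP.feasible 𝒜 b) X ↔ X = Xs) ∧
        (∀ X, EntropySDP.IsOptimal C ε (EntropySDP.strictFeasible 𝒜 b) X ↔ X = Xs) ∧
        EntropySDP.optValue C 𝒜 b ε = EntropySDP.cost C ε Xs ∧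
        (Function.Injective (EntropySDP.adj 𝒜) →
          IsGreatest (Set.range (EntropySDP.lagrangeDual C 𝒜 b ε))
            (EntropySDP.optValue C 𝒜 b ε : EReal) ∧
          IsGreatest (Set.range (EntropySDP.explicitDual C 𝒜 b ε))
            (EntropySDP.optValue C 𝒜 b ε) ∧
          ∃ ls : Fin m → ℝ,
            (∀ l, IsMaxOn (EntropySDP.explicitDual C 𝒜 b ε) Set.univ l ↔ l = ls) ∧
            EntropySDP.optValue C 𝒜 b ε = EntropySDP.explicitDual C 𝒜 b ε ls ∧
            EntropySDP.optValue C 𝒜 b ε = b ⬝ᵥ ls - ε * Xs.1.trace)) := by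
  open EntropySDP in
  refine ⟨existsUnique_isOptimal hΩ hε, lagrangeDual_eq_explicitDual hε, ?_⟩
  rintro ⟨X₀, hX₀, hpos⟩
  obtain ⟨ls, hls⟩ := exists_isMaxOn_explicitDual (C := C) hε hX₀.1 hpos
  have hXs := map_dualPoint_of_isMaxOn hε hls
  set Xs := dualPoint C 𝒜 ε ls with hXs_def
  have hXp : Xs.1.PosDef := posDef_dualPoint C 𝒜 ε ls
  have hXf : Xs ∈ feasible 𝒜 b := ⟨hXs, hXp.posSemidef⟩
  have hval : cost C ε Xs = explicitDual C 𝒜 b ε ls := by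
    have h := cost_sub_explicitDual (C := C) hε ls hXs
    rw [← hXs_def, relEntropy_self, mul_zero] at h
    linarith
  have hmin : ∀ X ∈ feasible 𝒜 b, cost C ε Xs ≤ cost C ε X := by
    intro X hX
    have h := cost_sub_explicitDual (C := C) hε ls hX.1
    have h2 := mul_nonneg hε.le (relEntropy_dualPoint_nonneg (C := C) (𝒜 := 𝒜) (ε := ε) ls hX.2)
    linarith
  have hopt : IsOptimal C ε (feasible 𝒜 b) Xs := ⟨hXf, hmin⟩
  have hsub : strictFeasible 𝒜 b ⊆ feasible 𝒜 b := fun X hX => ⟨hX.1, hX.2.posSemidef⟩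
  have hρ : optValue C 𝒜 b ε = cost C ε Xs :=
    IsLeast.csInf_eq ⟨⟨Xs, hXf, rfl⟩, by rintro _ ⟨X, hX, rfl⟩; exact hmin X hX⟩
  refine ⟨Xs, hXf, hXp, fun X => ⟨fun hX => eq_of_isOptimal hε hX hopt, fun h => h ▸ hopt⟩,
    fun X => ⟨fun hX => ?_, ?_⟩, hρ, fun hinj => ?_⟩
  -- `Xs` is itself strictly feasible, so a minimizer over the smaller set is optimal over all of
  -- `Ω`.
  · have hle : cost C ε X ≤ cost C ε Xs := hX.2 ⟨hXs, hXp⟩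
    exact eq_of_isOptimal hε ⟨hsub hX.1, fun Z hZ => hle.trans (hmin Z hZ)⟩ hopt
  · rintro rfl
    exact ⟨⟨hXs, hXp⟩, fun Z hZ => hmin Z (hsub hZ)⟩
  · rw [hρ, hval]
    have hmax : ∀ l, explicitDual C 𝒜 b ε l ≤ explicitDual C 𝒜 b ε ls :=
      fun l => hls (Set.mem_univ l)
    refine ⟨⟨⟨ls, lagrangeDual_eq_explicitDual hε ls⟩, ?_⟩, ⟨⟨ls, rfl⟩, ?_⟩, ls,
      fun l => ⟨fun hl => ?_, fun h => h ▸ hls⟩, rfl, rfl⟩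
    · rintro _ ⟨l, rfl⟩
      rw [lagrangeDual_eq_explicitDual hε]
      exact EReal.coe_le_coe_iff.2 (hmax l)
    · rintro _ ⟨l, rfl⟩
      exact hmax l
    -- Any maximizer `l` has zero gap against `Xs`, so equality in Klein's inequality makes `Xs` its
    -- dual point.
    · apply dualPoint_injective (C := C) hε hinj
      have hl' : explicitDual C 𝒜 b ε ls = explicitDual C 𝒜 b ε l :=
        le_antisymm (hl (Set.mem_univ ls)) (hmax l)
      have h := cost_sub_explicitDual (C := C) hε l hXs
      rw [hval, hl', sub_self, zero_eq_mul, or_iff_right hε.ne'] at h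
      exact Subtype.ext (eq_exp_of_relEntropy_eq_zero hXp.posSemidef
        (isHermitian_dualExponent C 𝒜 ε l) h).symm
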